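/- Let $V$ be a finite set of random variables; each $v\in V$ takes values in a measurable space $E_v$ with a $\sigma$-finite reference measure $\mu_v$, and all densities are taken with respect to product reference measures (identities between densities hold almost everywhere). A family of interventional densities consists of probability densities $f(v\mid do(x))$, one for each $\mathbf X\subseteq V$ and each value $x$ of $\mathbf X$, whose observational member $f(v)$ ($\mathbf X=\emptyset$) is positive; $f(y\mid do(x))$ is its marginal in $\mathbf Y$. The family is *compatible* with a directed acyclic graph $D$ on $V$ if for every $\mathbf X\subseteq V$ $$f(v\mid do(x))=\prod_{V_i\in V\setminus\mathbf X} f(v_i\mid \mathrm{pa}(v_i,D))\,\mathbf 1(v_{\mathbf X}=x).$$ A density $f$ is *faithful* to $D$ if, for pairwise disjoint $A,B,C\subseteq V$, conditional independence of $A$ and $B$ given $C$ under $f$ implies that $A$ and $B$ are d-separated given $C$ in $D$. A *causal model* induces a directed acyclic graph $D$ on $V$ and a family of interventional densities compatible with $D$ whose observational density $f(v)$ is faithful to $D$; $V$ may contain unobserved variables. Let $\mathbf X=\{X_1,\dots,X_k\}$, $k\ge 1$ (with $X_1,\dots,X_k$ distinct), $\{Y\}$ and $\mathbf W$ be pairwise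 disjoint sets of (observed) variables in a causal model with graph $D$. Suppose that $\mathbf W<X_1<\dots<X_k<Y$ is a causal ordering consistent with the model: no later variable is an ancestor in $D$ of an earlier one (no order is imposed inside $\mathbf W$; every node counts as an ancestor of itself). Suppose that there are $W_1,\dots,W_k\in\mathbf W$ and $\mathbf Z\subseteq\mathbf W\setminus\{W_1,\dots,W_k\}$ such that, for every $i\in\{1,\dots,k\}$, under the observational density $f(v)$ of the model, (i) $W_i$ and $Y$ are not conditionally independent given $\mathbf Z\cup\{X_1,\dots,X_{i-1}\}$, and (ii) $W_i$ and $Y$ are conditionally independent given $\mathbf Z\cup\{X_1,\dots,X_i\}$. Then $\mathbf X$ has a causal effect on $Y$ that is identifiable through the adjustment set $\mathbf Z$. That is: (a) for every $i$ there is a directed path $X_i\to\dots\to Y$ in $D$; (b) the causal effect of $\mathbf X$ on $Y$ is identifiable in $D$: any two families of interventional densities compatible with $D$ that have the same observational density have the same $f(y\mid do(x))$; (c) $\mathbf Z$ is an adjustment set relative to $(\mathbf X,Y)$ in $D$: for every family of interventional densities compatible with $D$ (over any state spaces and any $\sigma$-finite reference measures), $$f(y\mid do(x))=\int f(y\mid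 x,z)\,f(z)\,dz .$$ -/

import Mathlib

open MeasureTheory
open scoped ENNReal

universe u

namespace CausalDAG

section Graph

variable {V : Type*}

/-- `a` is an ancestor of `b` (every node is an ancestor of itself). -/
def IsAncestor (G : Digraph V) (a b : V) : Prop :=
  Relation.ReflTransGen G.Adj a b

/-- `a` has a causal effect on `b`: there is a directed path `a → ⋯ → b` with at least one edge. -/
def HasCausalEffect (G : Digraph V) (a b : V) : Prop :=
  Relation.TransGen G.Adj a b

/-- There is no directed cycle. -/
def IsAcyclic (G : Digraph V) : Prop :=
  ∀ v, ¬ Relation.TransGen G.Adj v v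

open Classical in
/-- The set of parents of a node. -/
noncomputable def parents [Fintype V] (G : Digraph V) (v : V) : Finset V :=
  Finset.univ.filter fun u => G.Adj u v

/-- `p` is a path from `a` to `b`: a sequence of distinct nodes in which successive nodes are
joined by an edge, in either direction. -/
structure IsPath (G : Digraph V) (a b : V) (p : List V) : Prop where
  nodup : p.Nodup
  chain : p.IsChain fun s t => G.Adj s t ∨ G.Adj t s
  head : p.head? = some a
  last : p.getLast? = some b

/-- The path `p` is open given `C`: each interior node `m`, with neighbours `s` and `t` on `p`, has
a descendant in `C` if it is a collider `s → m ← t`, and does not lie in `C` otherwise. -/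
def IsOpen (G : Digraph V) (C : Finset V) (p : List V) : Prop :=
  ∀ s m t : V, [s, m, t] <:+: p →
    ((G.Adj s m ∧ G.Adj t m) → ∃ d ∈ C, IsAncestor G m d) ∧
    (¬ (G.Adj s m ∧ G.Adj t m) → m ∉ C)

/-- `A` and `B` are d-separated given `C`. -/
def DSep (G : Digraph V) (A B C : Finset V) : Prop :=
  ∀ a ∈ A, ∀ b ∈ B, ∀ p : List V, IsPath G a b p → ¬ IsOpen G C p

/-- The blocks of the list `L` form a causal ordering: no node of a later block is an ancestor of
a node of an earlier block. -/
def IsCausalOrdering (G : Digraph V) (L : List (Finset V)) : Prop :=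
  L.Pairwise fun A B => ∀ a ∈ A, ∀ b ∈ B, ¬ IsAncestor G b a

end Graph

section Density

variable {V : Type*} [Fintype V] [DecidableEq V] {E : V → Type u} [∀ v, MeasurableSpace (E v)]

/-- The marginal density of the variables in `S`. It is a function of the whole configuration that
depends only on the coordinates in `S`; the other coordinates are integrated out. -/
noncomputable def marg (μ : ∀ v, Measure (E v)) (f : (∀ v, E v) → ℝ≥0∞) (S : Finset V) :
    (∀ v, E v) → ℝ≥0∞ :=
  ∫⋯∫⁻_Sᶜ, f ∂μ

/-- The conditional density `f(a | b) = f(a, b) / f(b)` of the variables in `A` given those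
in `B`. -/
noncomputable def condDens (μ : ∀ v, Measure (E v)) (f : (∀ v, E v) → ℝ≥0∞) (A B : Finset V) :
    (∀ v, E v) → ℝ≥0∞ :=
  fun v => marg μ f (A ∪ B) v / marg μ f B v

/-- Conditional independence of `A` and `B` given `C` under the density `f`:
`f(a, b, c) f(c) = f(a, c) f(b, c)` almost everywhere. -/
def CondIndep (μ : ∀ v, Measure (E v)) (f : (∀ v, E v) → ℝ≥0∞) (A B C : Finset V) : Prop :=
  ∀ᵐ v ∂Measure.pi μ,
    marg μ f (A ∪ B ∪ C) v * marg μ f C v = marg μ f (A ∪ C) v * marg μ f (B ∪ C) v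

/-- `f` is faithful to `G`: conditional independence implies d-separation. -/
def IsFaithful (G : Digraph V) (μ : ∀ v, Measure (E v)) (f : (∀ v, E v) → ℝ≥0∞) : Prop :=
  ∀ A B C : Finset V, Disjoint A B → Disjoint A C → Disjoint B C →
    CondIndep μ f A B C → DSep G A B C

/-- A family of interventional densities `f(v | do(x))`, one for each set `X` of variables and each
value `x`. The density `f(· | do(x))` is concentrated on the configurations `v` with `v_X = x`, and
on those it is a density in the remaining coordinates; so it is recorded as `dens X v`, where the
coordinates of `v` in `X` are the value `x`. The observational density is `dens ∅`; it is
positive. -/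
structure InterventionalFamily (μ : ∀ v, Measure (E v)) where
  dens : Finset V → (∀ v, E v) → ℝ≥0∞
  measurable_dens : ∀ X, Measurable (dens X)
  normalized : ∀ X v, (∫⋯∫⁻_Xᶜ, dens X ∂μ) v = 1
  pos : ∀ᵐ v ∂Measure.pi μ, 0 < dens ∅ v

/-- The observational density. -/
def InterventionalFamily.obs {μ : ∀ v, Measure (E v)} (F : InterventionalFamily μ) :
    (∀ v, E v) → ℝ≥0∞ :=
  F.dens ∅

/-- The interventional density `f(y | do(x))` of the variables in `Y`, as a function of the
coordinates in `X ∪ Y`. -/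
noncomputable def InterventionalFamily.doDens {μ : ∀ v, Measure (E v)}
    (F : InterventionalFamily μ) (X Y : Finset V) : (∀ v, E v) → ℝ≥0∞ :=
  ∫⋯∫⁻_(X ∪ Y)ᶜ, F.dens X ∂μ

/-- `G` is a causal Bayesian network compatible with `F`: the truncated factorization
`f(v | do(x)) = ∏_{i ∉ X} f(v_i | pa(v_i))` (on `v_X = x`) holds for every `X`. For `X = ∅` this is
Markov compatibility of the observational density with `G`. -/
def IsCompatible (G : Digraph V) {μ : ∀ v, Measure (E v)} (F : InterventionalFamily μ) : Prop :=
  ∀ X : Finset V, ∀ᵐ v ∂Measure.pi μ,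
    F.dens X v = ∏ i ∈ Xᶜ, condDens μ F.obs {i} (parents G i) v

/-- A causal model with variables `V`, where the variable `v` takes values in `E v` and densities
are taken with respect to the reference measures `μ v`: the induced DAG, and the induced
interventional densities, which are consistent with the DAG and whose observational member is
faithful to it. -/
structure CausalModel (μ : ∀ v, Measure (E v)) where
  graph : Digraph V
  acyclic : IsAcyclic graph
  family : InterventionalFamily μ
  compatible : IsCompatible graph family
  faithful : IsFaithful graph μ family.obs

end Density

section Adjustment

variable {V : Type*} [Fintype V] [DecidableEq V]

/-- `Z` is an adjustment set relative to `(X, Y)` in `G`: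
`f(y | do(x)) = ∫ f(y | x, z) f(z) dz` for all densities `f` consistent with `G`, over any state
spaces and any σ-finite reference measures. -/
def IsAdjustmentSet (G : Digraph V) (X Y Z : Finset V) : Prop :=
  ∀ (E : V → Type u) [∀ v, MeasurableSpace (E v)] (μ : ∀ v, Measure (E v))
    [∀ v, SigmaFinite (μ v)] (F : InterventionalFamily μ), IsCompatible G F →
    ∀ᵐ v ∂Measure.pi μ,
      F.doDens X Y v =
        (∫⋯∫⁻_Z, (fun w => condDens μ F.obs Y (X ∪ Z) w * marg μ F.obs Z w) ∂μ) v

/-- The causal effect of `X` on `Y` is identifiable in `G`: two compatible families with the same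
observational density have the same `f(y | do(x))`. -/
def IsIdentifiable (G : Digraph V) (X Y : Finset V) : Prop :=
  ∀ (E : V → Type u) [∀ v, MeasurableSpace (E v)] (μ : ∀ v, Measure (E v))
    [∀ v, SigmaFinite (μ v)] (F₁ F₂ : InterventionalFamily μ),
    IsCompatible G F₁ → IsCompatible G F₂ →
    (∀ᵐ v ∂Measure.pi μ, F₁.obs v = F₂.obs v) →
    ∀ᵐ v ∂Measure.pi μ, F₁.doDens X Y v = F₂.doDens X Y v

end Adjustment

end CausalDAG

/-! Write `C i = Z ∪ {X j | j < i}`. By the global Markov property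
(`condIndep_of_forall_not_isOpenWalk`), dependence of `w i` and `Y` given `C i` yields a walk `p`
open given `C i`. By faithfulness, independence given `C i ∪ {X i}` means that no walk from `w i` to
`Y` is open given that larger set. The causal ordering makes `X i` an ancestor neither of `w i` nor
of any node of `C i`.

Causal path: adding `X i` can block `p` only if `p` visits `X i` as a non-collider, hence has an
edge leaving it there. Followed in that direction, `p` meets no collider, since a collider would
have a descendant in `C i` and `X i` would be an ancestor of it. So that part of `p` is directed up
to its end, which is `Y` because `w i` is excluded.

Adjustment: suppose a walk from `X i` to `Y` without edges leaving `X` were open given `Z`. Gluing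
it to the part of `p` before `X i` makes `X i` a collider that lies in the conditioning set, so the
result is open given `C i ∪ {X i}`, a contradiction; if `p` misses `X i`, then `p` itself is open.
Hence `Z` satisfies the back-door criterion, which is derived from the truncated factorization by
splitting the kernels into two groups (`exists_separating_set`, `lmarginal_prod_kernel_eq_mul`).

Identifiability needs no graphical condition, as the factorization ranges over all of `V`. -/

namespace CausalDAG

/-! ### Open walks, and their reduction to open paths -/

section Walks

variable {V : Type*} {G : Digraph V} {C : Finset V}

/-- The interior node `m`, with neighbours `s` and `t`, does not block a walk given `C`. -/
def OpenAt (G : Digraph V) (C : Finset V) (s m t : V) : Prop :=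
  ((G.Adj s m ∧ G.Adj t m) → ∃ d ∈ C, IsAncestor G m d) ∧
    (¬ (G.Adj s m ∧ G.Adj t m) → m ∉ C)

/-- `p` is a walk from `a` to `b`, possibly with repeated nodes, that is open given `C`. -/
structure IsOpenWalk (G : Digraph V) (C : Finset V) (a b : V) (p : List V) : Prop where
  chain : p.IsChain fun s t => G.Adj s t ∨ G.Adj t s
  head : p.head? = some a
  last : p.getLast? = some b
  isOpen : IsOpen G C p

theorem OpenAt.symm {s m t : V} (h : OpenAt G C s m t) : OpenAt G C t m s :=
  ⟨fun hc => h.1 hc.symm, fun hc => h.2 fun h' => hc h'.symm⟩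

theorem isOpen_of_length_le_two {p : List V} (hp : p.length ≤ 2) : IsOpen G C p := by
  intro s m t h
  have := h.length_le
  simp at this
  omega

theorem IsOpen.of_infix {p q : List V} (hq : IsOpen G C q) (h : p <:+: q) : IsOpen G C p :=
  fun s m t hs => hq s m t (hs.trans h)

theorem isOpen_cons_cons_cons {s m t : V} {l : List V} :
    IsOpen G C (s :: m :: t :: l) ↔ OpenAt G C s m t ∧ IsOpen G C (m :: t :: l) := by
  constructor
  · intro h
    exact ⟨h s m t ⟨[], l, by simp⟩, h.of_infix ⟨[s], [], by simp⟩⟩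
  · rintro ⟨h₁, h₂⟩ a b c habc
    rcases List.infix_cons_iff.1 habc with h | h
    · simp only [List.cons_prefix_cons] at h
      obtain ⟨rfl, rfl, rfl, -⟩ := h
      exact h₁
    · exact h₂ a b c h

theorem isOpen_reverse {p : List V} : IsOpen G C p.reverse ↔ IsOpen G C p := by
  have key : ∀ q : List V, IsOpen G C q → IsOpen G C q.reverse := by
    intro q hq s m t h
    have h' : [t, m, s] <:+: q := by
      have := List.reverse_infix.2 h
      simpa using this
    exact OpenAt.symm (hq t m s h')
  exact ⟨fun h => by simpa using key _ h, key p⟩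

/-- The two pieces overlap in two nodes, so every triple of consecutive nodes lies in one of them.
-/
theorem isOpen_append_cons_cons {s m : V} {l₁ l₂ : List V} :
    IsOpen G C (l₁ ++ s :: m :: l₂) ↔
      IsOpen G C (l₁ ++ [s, m]) ∧ IsOpen G C (s :: m :: l₂) := by
  induction l₁ with
  | nil =>
    simp only [List.nil_append, iff_and_self]
    intro _
    exact isOpen_of_length_le_two (by simp)
  | cons a l ih =>
    rcases l with _ | ⟨b, l⟩
    · simp only [List.cons_append, List.nil_append, isOpen_cons_cons_cons]
      have := isOpen_of_length_le_two (G := G) (C := C) (p := [s, m]) (by simp)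
      tauto
    · rcases l with _ | ⟨c, l⟩
      · simp only [List.cons_append, List.nil_append, isOpen_cons_cons_cons] at ih ⊢
        tauto
      · simp only [List.cons_append, isOpen_cons_cons_cons (s := a)] at ih ⊢
        tauto

theorem IsOpenWalk.reverse {a b : V} {p : List V} (h : IsOpenWalk G C a b p) :
    IsOpenWalk G C b a p.reverse where
  chain := by
    rw [List.isChain_reverse]
    exact h.chain.imp fun _ _ h => h.symm
  head := by simpa using h.last
  last := by simpa using h.head
  isOpen := isOpen_reverse.2 h.isOpen

theorem IsAcyclic.not_adj (hG : IsAcyclic G) {a b : V} (h : G.Adj a b) : ¬ G.Adj b a :=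
  fun h' => hG a ((Relation.TransGen.single h).tail h')

theorem IsAcyclic.not_adj_self (hG : IsAcyclic G) (a : V) : ¬ G.Adj a a :=
  fun h => hG a (Relation.TransGen.single h)

/-- An open walk that leaves `x` along an outgoing edge is directed until it reaches its end,
unless `x` is an ancestor of the conditioning set. -/
theorem transGen_of_isOpen {x y t : V} {l : List V} (hadj : G.Adj x t)
    (hchain : (x :: t :: l).IsChain fun s t => G.Adj s t ∨ G.Adj t s)
    (hlast : (x :: t :: l).getLast? = some y) (hopen : IsOpen G C (x :: t :: l))
    (hx : ∀ d ∈ C, ¬ IsAncestor G x d) : Relation.TransGen G.Adj x y := by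
  induction l generalizing x t with
  | nil =>
    simp at hlast
    exact hlast ▸ Relation.TransGen.single hadj
  | cons u l ih =>
    have ht : ∀ d ∈ C, ¬ IsAncestor G t d := fun d hd h => hx d hd (.head hadj h)
    rw [isOpen_cons_cons_cons] at hopen
    rw [List.isChain_cons_cons] at hchain
    have hut : ¬ G.Adj u t := by
      intro h
      obtain ⟨d, hd, hd'⟩ := hopen.1.1 ⟨hadj, h⟩
      exact ht d hd hd'
    have htu : G.Adj t u := (List.isChain_cons_cons.1 hchain.2).1.resolve_right hut
    exact .head hadj (ih htu hchain.2 (by simpa using hlast) hopen.2 ht)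

theorem exists_eq_append_of_not_nodup {p : List V} (hp : ¬ p.Nodup) :
    ∃ (m : V) (l₁ l₂ l₃ : List V), p = l₁ ++ m :: (l₂ ++ m :: l₃) := by
  induction p with
  | nil => simp at hp
  | cons a p ih =>
    by_cases ha : a ∈ p
    · obtain ⟨l₂, l₃, rfl⟩ := List.append_of_mem ha
      exact ⟨a, [], l₂, l₃, rfl⟩
    · obtain ⟨m, l₁, l₂, l₃, rfl⟩ := ih (by simpa [ha] using hp)
      exact ⟨m, a :: l₁, l₂, l₃, rfl⟩

/-- Deleting the part of an open walk between two visits of the same node leaves it open. -/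
theorem IsOpenWalk.shorten (hG : IsAcyclic G) {a b m : V} {l₁ l₂ l₃ : List V}
    (h : IsOpenWalk G C a b (l₁ ++ m :: (l₂ ++ m :: l₃))) :
    IsOpenWalk G C a b (l₁ ++ m :: l₃) where
  chain := by
    have h₁ := List.isChain_split.1 h.chain
    rw [← List.cons_append] at h₁
    exact List.isChain_split.2 ⟨h₁.1, (List.isChain_split.1 h₁.2).2⟩
  head := by
    have := h.head
    rcases l₁ with _ | ⟨c, l₁⟩ <;> simpa using this
  last := by
    have := h.last
    simpa [List.getLast?_append, List.getLast?_cons] using this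
  isOpen := by
    have hpre : IsOpen G C (l₁ ++ [m]) := h.isOpen.of_infix ⟨[], l₂ ++ m :: l₃, by simp⟩
    have hsuf : IsOpen G C (m :: l₃) := h.isOpen.of_infix ⟨l₁ ++ m :: l₂, [], by simp⟩
    have hloop : IsOpen G C (m :: (l₂ ++ [m])) := h.isOpen.of_infix ⟨l₁, l₃, by simp⟩
    have hloopc : (m :: (l₂ ++ [m])).IsChain fun s t => G.Adj s t ∨ G.Adj t s :=
      h.chain.infix ⟨l₁, l₃, by simp⟩
    rcases l₁.eq_nil_or_concat with rfl | ⟨l₁, s, rfl⟩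
    · simpa using hsuf
    rcases l₃ with _ | ⟨t, l₃⟩
    · exact hpre
    simp only [List.concat_eq_append, List.append_assoc, List.cons_append, List.nil_append]
      at hpre h ⊢
    rw [isOpen_append_cons_cons, isOpen_cons_cons_cons]
    refine ⟨hpre, ?_, hsuf⟩
    rcases l₂ with _ | ⟨s', l₂⟩
    · simp at hloopc
      exact absurd hloopc (hG.not_adj_self m)
    have hfst : OpenAt G C s m s' := h.isOpen s m s' ⟨l₁, l₂ ++ m :: t :: l₃, by simp⟩
    have hsnd : ∃ t', OpenAt G C t' m t := by
      rcases (s' :: l₂).eq_nil_or_concat with h' | ⟨l, t', h'⟩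
      · simp at h'
      · refine ⟨t', h.isOpen t' m t ⟨l₁ ++ s :: m :: l, l₃, ?_⟩⟩
        simp [h']
    obtain ⟨t', hsnd⟩ := hsnd
    -- The two visits of `m` have neighbours `s, s'` and `t', t`; the shortened walk has `s, t`. If
    -- `s, t` form a collider at `m` but `s, s'` do not, the loop leaves `m`, and would be a
    -- directed cycle if `m` were not an ancestor of `C`. If `s, t` form no collider, one of the two
    -- visits was already a non-collider, so `m ∉ C`.
    constructor
    · rintro ⟨hsm, htm⟩
      by_cases hs' : G.Adj s' m
      · exact hfst.1 ⟨hsm, hs'⟩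
      · by_contra hcon
        push Not at hcon
        have hms' : G.Adj m s' := (List.isChain_cons_cons.1 hloopc).1.resolve_right hs'
        refine hG m (transGen_of_isOpen hms' hloopc ?_ hloop hcon)
        simp [List.getLast?_append, List.getLast?_cons]
    · intro hcol
      by_cases hsm : G.Adj s m
      · exact hsnd.2 fun h' => hcol ⟨hsm, h'.2⟩
      · exact hfst.2 fun h' => hsm h'.1

theorem IsOpenWalk.exists_isPath (hG : IsAcyclic G) {a b : V} {p : List V}
    (h : IsOpenWalk G C a b p) : ∃ q, IsPath G a b q ∧ IsOpen G C q := by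
  induction hn : p.length using Nat.strong_induction_on generalizing p with
  | _ n ih =>
    by_cases hp : p.Nodup
    · exact ⟨p, ⟨hp, h.chain, h.head, h.last⟩, h.isOpen⟩
    · obtain ⟨m, l₁, l₂, l₃, rfl⟩ := exists_eq_append_of_not_nodup hp
      refine ih _ ?_ (h.shorten hG) rfl
      simp at hn ⊢
      omega

/-- D-separation speaks of paths only; excluding walks too allows concatenation without care for
repeated nodes. -/
theorem DSep.not_isOpenWalk (hG : IsAcyclic G) {a b : V} (h : DSep G {a} {b} C) (p : List V) :
    ¬ IsOpenWalk G C a b p := by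
  intro hp
  obtain ⟨q, hq, hq'⟩ := hp.exists_isPath hG
  exact h a (by simp) b (by simp) q hq hq'

theorem IsOpenWalk.exists_eq_cons {a b : V} {p : List V} (h : IsOpenWalk G C a b p) :
    ∃ l, p = a :: l := by
  have := h.head
  rcases p with _ | ⟨c, p⟩
  · simp at this
  · simp at this
    exact ⟨p, by rw [this]⟩

theorem IsOpenWalk.cons {a b c : V} {l : List V} (h : IsOpenWalk G C a b (a :: l))
    (hadj : G.Adj c a ∨ G.Adj a c) (hopen : ∀ t ∈ l.head?, OpenAt G C c a t) :
    IsOpenWalk G C c b (c :: a :: l) where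
  chain := List.isChain_cons_cons.2 ⟨hadj, h.chain⟩
  head := rfl
  last := by simpa using h.last
  isOpen := by
    rcases l with _ | ⟨t, l⟩
    · exact isOpen_of_length_le_two (by simp)
    · exact isOpen_cons_cons_cons.2 ⟨hopen t (by simp), h.isOpen⟩

/-- An open walk starting outside the ancestors of `C` can be prolonged to any descendant of
its start. -/
theorem IsOpenWalk.exists_of_isAncestor (hG : IsAcyclic G) {a b c : V} {p : List V}
    (h : IsOpenWalk G C a b p) (hac : IsAncestor G a c) (ha : ∀ d ∈ C, ¬ IsAncestor G a d) :
    ∃ q, IsOpenWalk G C c b q := by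
  induction hac with
  | refl => exact ⟨p, h⟩
  | @tail x y hax hxy ih =>
    obtain ⟨q, hq⟩ := ih
    obtain ⟨l, rfl⟩ := hq.exists_eq_cons
    exact ⟨_, hq.cons (Or.inr hxy) fun t _ =>
      ⟨fun hc => absurd hc.1 (hG.not_adj hxy), fun _ hC => ha x hC hax⟩⟩

theorem isOpenWalk_singleton (a : V) : IsOpenWalk G C a a [a] :=
  ⟨by simp, rfl, rfl, isOpen_of_length_le_two (by simp)⟩

end Walks

/-! ### Graph separation as a splitting of the families -/

section Separation

variable {V : Type*} [Fintype V] {G : Digraph V} {C S : Finset V}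

theorem mem_parents {u v : V} : u ∈ parents G v ↔ G.Adj u v := by simp [parents]

/-- The nodes that enter the conditional density of `i`. -/
noncomputable def family [DecidableEq V] (G : Digraph V) (i : V) : Finset V := insert i (parents G i)

open Classical in
/-- The ancestors of the nodes in `S`. -/
noncomputable def ancestors (G : Digraph V) (S : Finset V) : Finset V :=
  Finset.univ.filter fun v => ∃ s ∈ S, IsAncestor G v s

theorem mem_ancestors {v : V} : v ∈ ancestors G S ↔ ∃ s ∈ S, IsAncestor G v s := by
  simp [ancestors]

theorem subset_ancestors (G : Digraph V) (S : Finset V) : S ⊆ ancestors G S :=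
  fun s hs => mem_ancestors.2 ⟨s, hs, .refl⟩

theorem mem_ancestors_of_adj {u v : V} (h : G.Adj u v) (hv : v ∈ ancestors G S) :
    u ∈ ancestors G S := by
  obtain ⟨s, hs, hvs⟩ := mem_ancestors.1 hv
  exact mem_ancestors.2 ⟨s, hs, .head h hvs⟩

/-- If no open walk joins `S` to `b` given `C`, then the ancestral set of all these nodes has a
part containing `b` and avoiding `S` which shares a family only with itself and `C`. -/
theorem exists_separating_set [DecidableEq V] (hG : IsAcyclic G) {b : V} (hbC : b ∉ C)
    (hsep : ∀ s ∈ S, ∀ p, ¬ IsOpenWalk G C s b p) :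
    ∃ B : Finset V, b ∈ B ∧ Disjoint B C ∧ Disjoint B S ∧
      B ⊆ ancestors G (insert b (S ∪ C)) ∧
      ∀ i ∈ ancestors G (insert b (S ∪ C)), ¬ Disjoint (family G i) B → family G i ⊆ B ∪ C := by
  classical
  set T := ancestors G (insert b (S ∪ C)) with hT
  -- `B` consists of the nodes of `T` outside `C` that an open walk joins to `b`.
  refine ⟨T.filter fun v => v ∉ C ∧ ∃ p, IsOpenWalk G C v b p, ?_, ?_, ?_, Finset.filter_subset _ _,
    ?_⟩
  · simp only [Finset.mem_filter]
    exact ⟨subset_ancestors _ _ (by simp), hbC, _, isOpenWalk_singleton b⟩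
  · rw [Finset.disjoint_left]
    intro v hv
    exact (Finset.mem_filter.1 hv).2.1
  · rw [Finset.disjoint_left]
    rintro v hv hvS
    obtain ⟨-, -, p, hp⟩ := Finset.mem_filter.1 hv
    exact hsep v hvS p hp
  · intro i hi hdisj u hu
    by_cases huC : u ∈ C
    · exact Finset.mem_union_right _ huC
    refine Finset.mem_union_left _ (Finset.mem_filter.2 ?_)
    obtain ⟨v, hvi, hv⟩ := Finset.not_disjoint_iff.1 hdisj
    obtain ⟨-, hvC, p, hp⟩ := Finset.mem_filter.1 hv
    -- The walk from `v ∈ B` is moved to start at `i`. The second clause ensures that, when a parent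
    -- `u` is put in front, `i` can lie in `C` only as a collider.
    have hwalk : ∃ l, IsOpenWalk G C i b (i :: l) ∧ (i ∉ C ∨ ∀ t ∈ l.head?, G.Adj t i) := by
      obtain ⟨l, rfl⟩ := hp.exists_eq_cons
      rcases Finset.mem_insert.1 hvi with rfl | hvi
      · exact ⟨l, hp, Or.inl hvC⟩
      · rw [mem_parents] at hvi
        refine ⟨_, hp.cons (Or.inr hvi) fun t _ =>
          ⟨fun hc => absurd hc.1 (hG.not_adj hvi), fun _ => hvC⟩, Or.inr ?_⟩
        simpa using hvi
    obtain ⟨l, hl, hil⟩ := hwalk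
    rcases Finset.mem_insert.1 hu with rfl | hu
    · exact ⟨hi, huC, _, hl⟩
    rw [mem_parents] at hu
    refine ⟨mem_ancestors_of_adj hu hi, huC, ?_⟩
    -- If `i` is an ancestor of `C`, prepending `u` is allowed even at a collider. Otherwise `i` is
    -- an ancestor of `b`, which gives `u → i → ⋯ → b`, or of `S`, and then the walk from `b` to `i`
    -- would extend to `S`.
    by_cases hiC : ∃ d ∈ C, IsAncestor G i d
    · refine ⟨_, hl.cons (Or.inl hu) fun t ht => ⟨fun _ => hiC, fun hc => ?_⟩⟩
      exact hil.resolve_right fun h => hc ⟨hu, h t ht⟩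
    · push Not at hiC
      obtain ⟨d, hd, hid⟩ := mem_ancestors.1 hi
      simp only [Finset.mem_insert, Finset.mem_union] at hd
      rcases hd with rfl | hd | hd
      · have h₀ : IsOpenWalk G C i u [i, u] :=
          (isOpenWalk_singleton u).cons (Or.inr hu) (by simp)
        obtain ⟨q, hq⟩ := h₀.exists_of_isAncestor hG hid hiC
        exact ⟨_, hq.reverse⟩
      · obtain ⟨q, hq⟩ := hl.exists_of_isAncestor hG hid hiC
        exact absurd hq (hsep d hd q)
      · exact absurd hid (hiC d hd)

end Separation

/-! ### Blocked walks and back-door walks -/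

section Backdoor

variable {V : Type*} {G : Digraph V} {C Z X : Finset V}

/-- The graph `G` without the edges leaving `X`. -/
def withoutOut (G : Digraph V) (X : Finset V) : Digraph V where
  Adj u v := G.Adj u v ∧ u ∉ X

theorem IsAcyclic.withoutOut (hG : IsAcyclic G) (X : Finset V) : IsAcyclic (withoutOut G X) :=
  fun v h => hG v (Relation.TransGen.mono (p := G.Adj) (fun _ _ h => h.1) _ _ h)

theorem IsAncestor.of_withoutOut {u v : V} (h : IsAncestor (withoutOut G X) u v) :
    IsAncestor G u v :=
  Relation.ReflTransGen.mono (p := G.Adj) (fun _ _ h => h.1) _ _ h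

theorem mem_of_infix_append_singleton {a m b x : V} {l : List V} (h : [a, m, b] <:+: l ++ [x]) :
    m ∈ l := by
  obtain ⟨u, v, h⟩ := h
  rcases v.eq_nil_or_concat with rfl | ⟨v, y, rfl⟩
  · have := congrArg List.dropLast h
    rw [List.append_nil, List.dropLast_concat, List.dropLast_append_cons] at this
    rw [← this]
    simp
  · have := congrArg List.dropLast h
    rw [List.concat_eq_append, ← List.append_assoc, List.dropLast_concat,
      List.dropLast_concat] at this
    rw [← this]
    simp

/-- Enlarging the conditioning set keeps a list open if no interior node is added. -/
theorem IsOpen.mono {D : Finset V} {p : List V} (h : IsOpen G C p) (hCD : C ⊆ D)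
    (hp : ∀ s m t, [s, m, t] <:+: p → m ∈ D → m ∈ C) : IsOpen G D p := by
  intro s m t hsmt
  refine ⟨fun hc => ?_, fun hc hm => (h s m t hsmt).2 hc (hp s m t hsmt hm)⟩
  obtain ⟨d, hd, hmd⟩ := (h s m t hsmt).1 hc
  exact ⟨d, hCD hd, hmd⟩

/-- A walk without edges leaving `X` that is open given `Z` is open in the full graph given `Z`
and any part of `X`. -/
theorem IsOpen.of_withoutOut (hG : IsAcyclic G) {D : Finset V} {p : List V}
    (hp : p.IsChain fun s t => (withoutOut G X).Adj s t ∨ (withoutOut G X).Adj t s)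
    (h : IsOpen (withoutOut G X) Z p) (hZD : Z ⊆ D) (hD : ∀ v ∈ D, v ∈ Z ∨ v ∈ X) :
    IsOpen G D p := by
  intro s m t hsmt
  have hc := hp.infix hsmt
  simp only [List.isChain_cons_cons, List.isChain_singleton, and_true] at hc
  constructor
  · rintro ⟨hs, ht⟩
    have hs' := hc.1.resolve_right fun h => hG.not_adj hs h.1
    have ht' := hc.2.resolve_left fun h => hG.not_adj ht h.1
    obtain ⟨d, hd, hmd⟩ := (h s m t hsmt).1 ⟨hs', ht'⟩
    exact ⟨d, hZD hd, hmd.of_withoutOut⟩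
  · intro hcol hm
    rcases hD m hm with hmZ | hmX
    · exact (h s m t hsmt).2 (fun h' => hcol ⟨h'.1.1, h'.2.1⟩) hmZ
    -- No edge of the walk leaves `X`, so an interior node in `X` is a collider.
    · exact hcol ⟨(hc.1.resolve_right fun h => h.2 hmX).1, (hc.2.resolve_left fun h => h.2 hmX).1⟩

/-- If adding `x` to the conditioning set blocks an open walk from `w` to `y`, where `x` is an
ancestor neither of `w` nor of the conditioning set, then there is a directed path from `x`
to `y`. -/
theorem IsOpenWalk.transGen_of_blocked [DecidableEq V] {w x y : V} {p : List V}
    (hp : IsOpenWalk G C w y p) (hblock : ¬ IsOpen G (insert x C) p)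
    (hxC : ∀ d ∈ C, ¬ IsAncestor G x d) (hxw : ¬ IsAncestor G x w) :
    Relation.TransGen G.Adj x y := by
  rw [IsOpen] at hblock
  push Not at hblock
  obtain ⟨s, m, t, hsmt, hblock⟩ := hblock
  have hm := hp.isOpen s m t hsmt
  by_cases hcol : G.Adj s m ∧ G.Adj t m
  · obtain ⟨d, hd, hmd⟩ := hm.1 hcol
    have := hblock fun _ => ⟨d, Finset.mem_insert_of_mem hd, hmd⟩
    exact absurd hcol.2 (this.1 hcol.1)
  · have hmx : m ∈ insert x C := (hblock fun h => absurd h hcol).2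
    obtain rfl : m = x := (Finset.mem_insert.1 hmx).resolve_right (hm.2 hcol)
    have hc := hp.chain.infix hsmt
    simp only [List.isChain_cons_cons, List.isChain_singleton, and_true] at hc
    obtain ⟨l₁, l₂, rfl⟩ := hsmt
    -- At the non-collider `x` some edge leaves: forwards it leads to `y`, backwards to `w`, which
    -- is excluded.
    by_cases hs : G.Adj s m
    · have ht : G.Adj m t := hc.2.resolve_right fun h => hcol ⟨hs, h⟩
      have hinf : m :: t :: l₂ <:+: l₁ ++ [s, m, t] ++ l₂ := ⟨l₁ ++ [s], [], by simp⟩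
      refine transGen_of_isOpen ht (hp.chain.infix hinf) ?_ (hp.isOpen.of_infix hinf) hxC
      have := hp.last
      simpa [List.getLast?_append, List.getLast?_cons] using this
    · have hs' : G.Adj m s := hc.1.resolve_left hs
      have hinf : m :: s :: l₁.reverse <:+: (l₁ ++ [s, m, t] ++ l₂).reverse :=
        ⟨l₂.reverse ++ [t], [], by simp⟩
      refine absurd (transGen_of_isOpen hs' (hp.reverse.chain.infix hinf) ?_
        (hp.reverse.isOpen.of_infix hinf) hxC).to_reflTransGen hxw
      have := hp.reverse.last
      simpa [List.getLast?_append, List.getLast?_cons] using this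

/-- The part of an open walk up to its first visit of `x`, followed by a back-door walk from `x`,
is open once `x` is added to the conditioning set. -/
theorem IsOpenWalk.exists_insert_of_withoutOut [DecidableEq V] (hG : IsAcyclic G) {w x y : V}
    {p q : List V} (hp : IsOpenWalk G C w y p) (hxC : ∀ d ∈ C, ¬ IsAncestor G x d)
    (hxw : ¬ IsAncestor G x w) (hq : IsOpenWalk (withoutOut G X) Z x y q) (hxX : x ∈ X)
    (hxy : x ≠ y) (hZC : Z ⊆ C) (hCX : ∀ v ∈ C, v ∈ Z ∨ v ∈ X) :
    ∃ r, IsOpenWalk G (insert x C) w y r := by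
  by_cases hxp : x ∈ p
  swap
  · refine ⟨p, hp.chain, hp.head, hp.last, hp.isOpen.mono (Finset.subset_insert _ _) ?_⟩
    intro s m t hsmt hm
    refine (Finset.mem_insert.1 hm).resolve_left ?_
    rintro rfl
    exact hxp (hsmt.subset (by simp))
  obtain ⟨l₁, l₂, rfl, hxl⟩ := List.eq_append_cons_of_mem hxp
  have hwx : w ≠ x := fun h => hxw (h ▸ .refl)
  obtain ⟨q, rfl⟩ := hq.exists_eq_cons
  rcases q with _ | ⟨t, q⟩
  · have := hq.last
    simp at this
    exact absurd this hxy
  rcases l₁.eq_nil_or_concat with rfl | ⟨l₁, s, rfl⟩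
  · have := hp.head
    simp at this
    exact absurd this.symm hwx
  simp only [List.concat_eq_append, List.append_assoc, List.cons_append, List.nil_append]
    at hp hxl
  have hp₁ : l₁ ++ [s, x] <:+: l₁ ++ s :: x :: l₂ := ⟨[], l₂, by simp⟩
  have hpc := hp.chain.infix hp₁
  have htx : G.Adj t x :=
    ((List.isChain_cons_cons.1 hq.chain).1.resolve_left fun h => h.2 hxX).1
  -- An edge `x → s` would make the initial part, read backwards, a directed path from `x` to `w`.
  have hsx : G.Adj s x := by
    have hinf : x :: s :: l₁.reverse <:+: (l₁ ++ s :: x :: l₂).reverse :=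
      ⟨l₂.reverse, [], by simp⟩
    by_contra hsx
    have hxs : G.Adj x s := by
      have := hpc.infix (l₁ := [s, x]) ⟨l₁, [], by simp⟩
      simp only [List.isChain_cons_cons, List.isChain_singleton, and_true] at this
      exact this.resolve_left hsx
    refine hxw (transGen_of_isOpen hxs (hp.reverse.chain.infix hinf) ?_
        (hp.reverse.isOpen.of_infix hinf) hxC).to_reflTransGen
    have := hp.reverse.last
    simpa [List.getLast?_append, List.getLast?_cons] using this
  refine ⟨l₁ ++ s :: x :: t :: q, ?_, ?_, ?_, ?_⟩
  · rw [List.isChain_append_cons_cons] at hpc ⊢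
    refine ⟨hpc.1, Or.inl hsx, hq.chain.imp fun _ _ h => h.imp And.left And.left⟩
  · have := hp.head
    rcases l₁ with _ | ⟨c, l₁⟩ <;> simpa using this
  · have := hq.last
    simpa [List.getLast?_append, List.getLast?_cons] using this
  · rw [isOpen_append_cons_cons, isOpen_cons_cons_cons]
    refine ⟨(hp.isOpen.of_infix hp₁).mono (Finset.subset_insert _ _) fun a m b hamb hm => ?_,
      ⟨fun _ => ⟨x, by simp, .refl⟩, fun h => absurd ⟨hsx, htx⟩ h⟩,
      hq.isOpen.of_withoutOut hG hq.chain (hZC.trans (Finset.subset_insert _ _)) ?_⟩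
    · refine (Finset.mem_insert.1 hm).resolve_left ?_
      rintro rfl
      refine hxl ?_
      have : [a, m, b] <:+: (l₁ ++ [s]) ++ [m] := by simpa using hamb
      simpa using mem_of_infix_append_singleton this
    · intro v hv
      rcases Finset.mem_insert.1 hv with rfl | hv
      · exact Or.inr hxX
      · exact hCX v hv

end Backdoor

/-! ### Marginal integrals up to null sets -/

section Marginals

variable {V : Type*} [DecidableEq V] {E : V → Type u} [∀ v, MeasurableSpace (E v)]
  {μ : ∀ v, Measure (E v)}

theorem lmarginal_apply_eq_zero_iff {f : (∀ v, E v) → ℝ≥0∞} (hf : Measurable f) {S : Finset V}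
    {x : ∀ v, E v} :
    (∫⋯∫⁻_S, f ∂μ) x = 0 ↔
      ∀ᵐ y ∂Measure.pi fun i : S => μ i, f (Function.updateFinset x S y) = 0 :=
  lintegral_eq_zero_iff (hf.comp measurable_updateFinset)

variable [∀ v, SigmaFinite (μ v)]

theorem lmarginal_of_eq_union {f : (∀ v, E v) → ℝ≥0∞} (hf : Measurable f) {R S T : Finset V}
    (hR : R = S ∪ T) (hST : Disjoint S T) :
    ∫⋯∫⁻_R, f ∂μ = ∫⋯∫⁻_S, ∫⋯∫⁻_T, f ∂μ ∂μ := by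
  rw [hR, lmarginal_union μ f hf hST]

variable [Fintype V]

/-- Fubini: integrating the indicator of a null set over `S`, then `Sᶜ`, then `S` again gives zero,
because the first two integrations already do. No finiteness of `μ` is needed. -/
theorem ae_ae_updateFinset {P : (∀ v, E v) → Prop} (h : ∀ᵐ x ∂Measure.pi μ, P x) (S : Finset V) :
    ∀ᵐ x ∂Measure.pi μ, ∀ᵐ y ∂Measure.pi fun i : S => μ i, P (Function.updateFinset x S y) := by
  rcases isEmpty_or_nonempty (∀ v, E v) with hE | ⟨⟨x₀⟩⟩
  · exact Filter.Eventually.of_forall fun x => hE.elim x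
  set N := toMeasurable (Measure.pi μ) {x | ¬ P x} with hN
  set g : (∀ v, E v) → ℝ≥0∞ := N.indicator 1 with hg
  have hNm : MeasurableSet N := measurableSet_toMeasurable _ _
  have hgm : Measurable g := measurable_one.indicator hNm
  have hg0 : ∫⋯∫⁻_Finset.univ, g ∂μ = fun _ => 0 := by
    rw [lmarginal_univ, hg, lintegral_indicator_one hNm, hN, measure_toMeasurable]
    funext _
    exact h
  have hzero : ∫⁻ x, (∫⋯∫⁻_S, g ∂μ) x ∂Measure.pi μ = 0 := by
    rw [lintegral_eq_lmarginal_univ x₀,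
      lmarginal_of_eq_union (hgm.lmarginal μ) (Finset.union_compl S).symm disjoint_compl_right,
      ← lmarginal_of_eq_union hgm (Finset.union_compl S ▸ Finset.union_comm _ _)
        disjoint_compl_left, hg0]
    simp [lmarginal]
  rw [lintegral_eq_zero_iff (hgm.lmarginal μ)] at hzero
  filter_upwards [hzero] with x hx
  filter_upwards [(lmarginal_apply_eq_zero_iff hgm).1 hx] with y hy
  by_contra hP
  have : Function.updateFinset x S y ∈ N := subset_toMeasurable _ _ hP
  simp [hg, this] at hy

theorem lmarginal_congr_ae {f g : (∀ v, E v) → ℝ≥0∞} (h : f =ᵐ[Measure.pi μ] g) (S : Finset V) :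
    ∫⋯∫⁻_S, f ∂μ =ᵐ[Measure.pi μ] ∫⋯∫⁻_S, g ∂μ := by
  filter_upwards [ae_ae_updateFinset h S] with x hx
  exact lintegral_congr_ae hx

theorem lmarginal_pos_ae [∀ v, NeZero (μ v)] {f : (∀ v, E v) → ℝ≥0∞} (hf : Measurable f)
    (h : ∀ᵐ x ∂Measure.pi μ, 0 < f x) (S : Finset V) :
    ∀ᵐ x ∂Measure.pi μ, 0 < (∫⋯∫⁻_S, f ∂μ) x := by
  filter_upwards [ae_ae_updateFinset h S] with x hx
  rw [pos_iff_ne_zero]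
  intro h0
  have hfalse : ∀ᵐ y ∂Measure.pi fun i : S => μ i, False := by
    filter_upwards [hx, (lmarginal_apply_eq_zero_iff hf).1 h0] with y hy hy'
    exact hy.ne' hy'
  have hmz : Measure.pi (fun i : S => μ i) = 0 := by simpa using hfalse
  have := congrArg (fun ν => ν Set.univ) hmz
  simp only [Measure.pi_univ, Measure.coe_zero, Pi.zero_apply, Finset.prod_eq_zero_iff] at this
  obtain ⟨i, -, hi⟩ := this
  exact NeZero.ne (μ i) (Measure.measure_univ_eq_zero.1 hi)

/-- On each slice along `Sᶜ` the marginal has the finite total integral of `f`, so it is infinite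
only on a null part of the slice. -/
theorem lmarginal_lt_top_ae {f : (∀ v, E v) → ℝ≥0∞} (hf : Measurable f)
    (h : ∫⁻ x, f x ∂Measure.pi μ ≠ ∞) (S : Finset V) :
    ∀ᵐ x ∂Measure.pi μ, (∫⋯∫⁻_S, f ∂μ) x < ∞ := by
  rcases isEmpty_or_nonempty (∀ v, E v) with hE | ⟨⟨x₀⟩⟩
  · exact Filter.Eventually.of_forall fun x => hE.elim x
  set h' := ∫⋯∫⁻_S, f ∂μ with hh'
  have hm : Measurable h' := hf.lmarginal μ
  set N : Set (∀ v, E v) := {x | h' x = ∞} with hN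
  have hNm : MeasurableSet N := hm (measurableSet_singleton _)
  have hgm : Measurable (N.indicator 1 : (∀ v, E v) → ℝ≥0∞) := measurable_one.indicator hNm
  have h0 : ∫⋯∫⁻_Sᶜ, N.indicator 1 ∂μ = fun _ => 0 := by
    funext x
    have hfin : (∫⋯∫⁻_Sᶜ, h' ∂μ) x ≠ ∞ := by
      rw [hh', ← lmarginal_of_eq_union hf (Finset.union_compl S ▸ Finset.union_comm _ _)
        disjoint_compl_left, lmarginal_univ]
      exact h
    have := ae_lt_top (hm.comp measurable_updateFinset) hfin
    rw [lmarginal_apply_eq_zero_iff hgm]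
    filter_upwards [this] with y hy
    simp only [Function.comp_apply] at hy
    simp [hN, hy.ne]
  have hzero : ∫⁻ x, N.indicator 1 x ∂Measure.pi μ = 0 := by
    rw [lintegral_eq_lmarginal_univ x₀,
      lmarginal_of_eq_union hgm (Finset.union_compl S).symm disjoint_compl_right, h0]
    simp [lmarginal]
  rw [lintegral_indicator_one hNm] at hzero
  have : ∀ᵐ x ∂Measure.pi μ, x ∉ N := by
    rw [ae_iff]
    simpa using hzero
  filter_upwards [this] with x hx
  exact lt_top_iff_ne_top.2 hx

end Marginals

/-! ### Integrating products of functions of few coordinates -/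

section Depends

variable {V : Type*} {E : V → Type u}

theorem _root_.DependsOn.finset_prod {f : V → (∀ v, E v) → ℝ≥0∞} {J : Finset V} {s : Set V}
    (h : ∀ i ∈ J, DependsOn (f i) s) : DependsOn (∏ i ∈ J, f i) s := by
  intro x y hxy
  simp only [Finset.prod_apply]
  exact Finset.prod_congr rfl fun i hi => h i hi hxy

variable [DecidableEq V] [∀ v, MeasurableSpace (E v)] {μ : ∀ v, Measure (E v)}

theorem _root_.DependsOn.lmarginal {f : (∀ v, E v) → ℝ≥0∞} {s : Set V} (h : DependsOn f s)
    (T : Finset V) : DependsOn (∫⋯∫⁻_T, f ∂μ) (s \ T) := by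
  intro x y hxy
  refine lintegral_congr fun z => h fun i hi => ?_
  by_cases hT : i ∈ T
  · simp [Function.updateFinset, hT]
  · simpa [Function.updateFinset, hT] using hxy i ⟨hi, hT⟩

theorem lmarginal_mul_of_dependsOn {f g : (∀ v, E v) → ℝ≥0∞} {s : Set V} (hf : DependsOn f s)
    (hg : Measurable g) {T : Finset V} (hsT : Disjoint s T) :
    ∫⋯∫⁻_T, f * g ∂μ = f * ∫⋯∫⁻_T, g ∂μ := by
  funext x
  have hx : ∀ y, f (Function.updateFinset x T y) = f x := fun y => hf fun i hi => by
    have : i ∉ T := fun h => Set.disjoint_left.1 hsT hi h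
    simp [Function.updateFinset, this]
  simp only [lmarginal, Pi.mul_apply, hx]
  exact lintegral_const_mul _ (hg.comp measurable_updateFinset)

theorem lmarginal_union_mul [∀ v, SigmaFinite (μ v)] {f g : (∀ v, E v) → ℝ≥0∞} {s t : Set V}
    (hf : DependsOn f s) (hg : DependsOn g t) (hfm : Measurable f) (hgm : Measurable g)
    {S T : Finset V} (hST : Disjoint S T) (hsT : Disjoint s T) (htS : Disjoint t S) :
    ∫⋯∫⁻_(S ∪ T), f * g ∂μ = (∫⋯∫⁻_S, f ∂μ) * ∫⋯∫⁻_T, g ∂μ := by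
  rw [lmarginal_union μ _ (hfm.mul hgm) hST, lmarginal_mul_of_dependsOn hf hgm hsT, mul_comm f,
    lmarginal_mul_of_dependsOn (hg.lmarginal T) hfm (htS.mono_left Set.sdiff_subset), mul_comm]

end Depends

/-! ### Products of conditional densities -/

section Kernels

variable {V : Type*} [Fintype V] [DecidableEq V] {E : V → Type u} [∀ v, MeasurableSpace (E v)]
  {μ : ∀ v, Measure (E v)} {f : (∀ v, E v) → ℝ≥0∞} {G : Digraph V}

theorem dependsOn_marg (S : Finset V) : DependsOn (marg μ f S) S := by
  have := (dependsOn_univ f).lmarginal (μ := μ) Sᶜ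
  refine this.mono ?_
  intro i hi
  simpa using hi

/-- The conditional density of a node given its parents. -/
noncomputable def kernel (G : Digraph V) (μ : ∀ v, Measure (E v)) (f : (∀ v, E v) → ℝ≥0∞)
    (i : V) : (∀ v, E v) → ℝ≥0∞ :=
  condDens μ f {i} (parents G i)

theorem dependsOn_kernel (i : V) : DependsOn (kernel G μ f i) (family G i) := by
  intro x y hxy
  have h₁ := dependsOn_marg (μ := μ) (f := f) ({i} ∪ parents G i) (x := x) (y := y) hxy
  have h₂ := dependsOn_marg (μ := μ) (f := f) (parents G i) (x := x) (y := y)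
    fun j hj => hxy j (by simpa [family] using Or.inr hj)
  simp only [kernel, condDens, h₁, h₂]

variable [∀ v, SigmaFinite (μ v)]

theorem measurable_marg (hf : Measurable f) (S : Finset V) : Measurable (marg μ f S) :=
  hf.lmarginal μ

theorem measurable_kernel (hf : Measurable f) (i : V) : Measurable (kernel G μ f i) :=
  (measurable_marg hf _).div (measurable_marg hf _)

theorem measurable_prod_kernel (hf : Measurable f) (J : Finset V) :
    Measurable (∏ i ∈ J, kernel G μ f i) := by
  rw [Finset.prod_fn]
  exact Finset.measurable_prod J fun i _ => measurable_kernel hf i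

/-- Integrating the numerator over the node gives the denominator; positivity and finite mass keep
that away from `0` and `∞` almost everywhere. -/
theorem lmarginal_kernel [∀ v, NeZero (μ v)] (hG : IsAcyclic G) (hf : Measurable f)
    (hpos : ∀ᵐ x ∂Measure.pi μ, 0 < f x) (hfin : ∫⁻ x, f x ∂Measure.pi μ ≠ ∞) (i : V) :
    ∫⋯∫⁻_{i}, kernel G μ f i ∂μ =ᵐ[Measure.pi μ] 1 := by
  have hi : i ∉ parents G i := fun h => hG.not_adj_self i (mem_parents.1 h)
  have hker : kernel G μ f i =
      (marg μ f (parents G i))⁻¹ * marg μ f ({i} ∪ parents G i) := by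
    funext x
    simp [kernel, condDens, ENNReal.div_eq_inv_mul]
  have hdep : DependsOn (marg μ f (parents G i))⁻¹ (parents G i) := by
    intro x y hxy
    simp only [Pi.inv_apply, dependsOn_marg (μ := μ) (f := f) (parents G i) hxy]
  have hunion : (parents G i)ᶜ = {i} ∪ ({i} ∪ parents G i)ᶜ := by
    ext j
    by_cases hj : j = i
    · simp [hj, hi]
    · simp [hj]
  rw [hker, lmarginal_mul_of_dependsOn hdep (measurable_marg hf _) (by simpa using hi), marg, marg,
    ← lmarginal_of_eq_union hf hunion (by simp)]
  filter_upwards [lmarginal_pos_ae hf hpos (parents G i)ᶜ,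
    lmarginal_lt_top_ae hf hfin (parents G i)ᶜ] with x hx hx'
  exact ENNReal.inv_mul_cancel hx.ne' hx'.ne

theorem exists_parents_subset_of_ne_univ (hG : IsAcyclic G) {T : Finset V}
    (hT : T ≠ Finset.univ) : ∃ s ∉ T, parents G s ⊆ T := by
  have hirr : Std.Irrefl (Relation.TransGen G.Adj) := ⟨hG⟩
  have hwf : WellFounded (Relation.TransGen G.Adj) := Finite.wellFounded_of_trans_of_irrefl _
  obtain ⟨s₀, hs₀⟩ : ∃ s, s ∉ T := by
    by_contra! h
    exact hT (Finset.eq_univ_iff_forall.2 h)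
  obtain ⟨s, hs, hmin⟩ := hwf.has_min {s | s ∉ T} ⟨s₀, hs₀⟩
  refine ⟨s, hs, fun u hu => ?_⟩
  by_contra huT
  exact hmin u huT (.single (mem_parents.1 hu))

/-- Integrating out the nodes outside an ancestral set removes their kernels. -/
theorem lmarginal_sdiff_prod_kernel [∀ v, NeZero (μ v)] (hG : IsAcyclic G) (hf : Measurable f)
    (hpos : ∀ᵐ x ∂Measure.pi μ, 0 < f x) (hfin : ∫⁻ x, f x ∂Measure.pi μ ≠ ∞)
    (I T : Finset V) (hT : ∀ v ∈ T, parents G v ⊆ T) :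
    ∫⋯∫⁻_(I \ T), ∏ i ∈ I, kernel G μ f i ∂μ =ᵐ[Measure.pi μ] ∏ i ∈ I ∩ T, kernel G μ f i := by
  induction hn : Tᶜ.card generalizing T with
  | zero =>
    have : T = Finset.univ := by simpa using hn
    rw [this, Finset.sdiff_eq_empty_iff_subset.2 (Finset.subset_univ _), lmarginal_empty,
      Finset.inter_univ]
  | succ n ih =>
    have hTu : T ≠ Finset.univ := by rintro rfl; simp at hn
    obtain ⟨s, hs, hsT⟩ := exists_parents_subset_of_ne_univ hG hTu
    have ih' := ih (insert s T) ?_ ?_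
    rotate_left
    · intro v hv
      rcases Finset.mem_insert.1 hv with rfl | hv
      · exact hsT.trans (Finset.subset_insert _ _)
      · exact (hT v hv).trans (Finset.subset_insert _ _)
    · rw [Finset.compl_insert, Finset.card_erase_of_mem (by simpa using hs), hn]
      rfl
    -- The parents of `s` lie in `T`. If `s ∈ I`, integration over the later nodes leaves the kernel
    -- of `s`, which integrates to one, times kernels that do not involve `s`.
    by_cases hsI : s ∈ I
    · have hunion : I \ T = {s} ∪ (I \ insert s T) := by
        ext j
        by_cases hj : j = s
        · simp [hj, hs, hsI]
        · simp [hj]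
      have hinter : I ∩ insert s T = insert s (I ∩ T) := by
        rw [Finset.inter_insert_of_mem hsI]
      rw [lmarginal_of_eq_union (measurable_prod_kernel hf I) hunion (by simp)]
      rw [hinter, Finset.prod_insert (by simp [hs]), mul_comm] at ih'
      refine (lmarginal_congr_ae ih' {s}).trans ?_
      have hdep : DependsOn (∏ i ∈ I ∩ T, kernel G μ f i) (T : Set V) := by
        refine DependsOn.finset_prod fun i hi => (dependsOn_kernel i).mono ?_
        have hiT := (Finset.mem_inter.1 hi).2
        rw [Finset.coe_subset]
        exact Finset.insert_subset hiT (hT i hiT)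
      rw [lmarginal_mul_of_dependsOn hdep (measurable_kernel hf s) (by simpa using hs)]
      filter_upwards [lmarginal_kernel hG hf hpos hfin s] with x hx
      simp [hx]
    · have h₁ : I \ insert s T = I \ T := by
        rw [Finset.sdiff_insert_of_notMem hsI]
      have h₂ : I ∩ insert s T = I ∩ T := Finset.inter_insert_of_notMem hsI
      rwa [h₁, h₂] at ih'

/-- A product of kernels whose families meet `B` only inside `B ∪ P` is integrated separately over
`B` and over the other nodes, if the variables in `P` are kept. -/
theorem lmarginal_prod_kernel_eq_mul (hf : Measurable f) {B D J P T : Finset V} (hBT : B ⊆ T)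
    (hPD : P ⊆ D) (hJ : ∀ i ∈ J, ¬ Disjoint (family G i) B → family G i ⊆ B ∪ P) :
    ∫⋯∫⁻_(T \ D), ∏ i ∈ J, kernel G μ f i ∂μ =
      (∫⋯∫⁻_(B \ D), ∏ i ∈ J with ¬ Disjoint (family G i) B, kernel G μ f i ∂μ) *
        ∫⋯∫⁻_((T \ B) \ D), ∏ i ∈ J with Disjoint (family G i) B, kernel G μ f i ∂μ := by
  have hTD : T \ D = (B \ D) ∪ ((T \ B) \ D) := by
    rw [← Finset.union_sdiff_distrib, Finset.union_sdiff_of_subset hBT]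
  rw [hTD, ← Finset.prod_filter_not_mul_prod_filter J (fun i => Disjoint (family G i) B)]
  refine lmarginal_union_mul (s := ((B ∪ P : Finset V) : Set V)) (t := ((Bᶜ : Finset V) : Set V))
    ?_ ?_ (measurable_prod_kernel hf _) (measurable_prod_kernel hf _) ?_ ?_ ?_
  · refine DependsOn.finset_prod fun i hi => (dependsOn_kernel i).mono ?_
    rw [Finset.mem_filter] at hi
    exact Finset.coe_subset.2 (hJ i hi.1 hi.2)
  · refine DependsOn.finset_prod fun i hi => (dependsOn_kernel i).mono ?_
    rw [Finset.mem_filter] at hi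
    rw [Finset.coe_subset]
    exact fun j hj => Finset.mem_compl.2 (Finset.disjoint_left.1 hi.2 hj)
  · rw [Finset.disjoint_left]
    intro i hi hi'
    simp only [Finset.mem_sdiff] at hi hi'
    exact hi'.1.2 hi.1
  · rw [Finset.disjoint_coe, Finset.disjoint_left]
    intro i hi hi'
    simp only [Finset.mem_sdiff, Finset.mem_union] at hi hi'
    rcases hi with hi | hi
    · exact hi'.1.2 hi
    · exact hi'.2 (hPD hi)
  · rw [Finset.disjoint_coe, Finset.disjoint_left]
    intro i hi hi'
    simp only [Finset.mem_sdiff, Finset.mem_compl] at hi hi'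
    exact hi hi'.1

end Kernels

theorem sdiff_union_of_disjoint {V : Type*} [DecidableEq V] {A C S : Finset V} (h : Disjoint S A) :
    S \ (A ∪ C) = S \ C := by
  rw [Finset.sdiff_union_distrib, Finset.sdiff_eq_self_of_disjoint h]
  exact Finset.inter_eq_right.2 Finset.sdiff_subset

/-! ### Markov property, identifiability and the back-door criterion -/

section Models

variable {V : Type*} [Fintype V] [DecidableEq V] {E : V → Type u} [∀ v, MeasurableSpace (E v)]
  {μ : ∀ v, Measure (E v)} {G : Digraph V}

theorem IsCompatible.dens_ae_eq {F : InterventionalFamily μ} (hF : IsCompatible G F)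
    (X : Finset V) : F.dens X =ᵐ[Measure.pi μ] ∏ i ∈ Xᶜ, kernel G μ F.obs i := by
  filter_upwards [hF X] with v hv
  rw [hv, Finset.prod_apply]
  rfl

namespace InterventionalFamily

variable (F : InterventionalFamily μ)

theorem measurable_obs : Measurable F.obs := F.measurable_dens ∅

variable [∀ v, SigmaFinite (μ v)]

theorem lintegral_obs [Nonempty (∀ v, E v)] : ∫⁻ v, F.obs v ∂Measure.pi μ = 1 := by
  obtain ⟨x⟩ := ‹Nonempty (∀ v, E v)›
  rw [lintegral_eq_lmarginal_univ x]
  simpa [obs] using F.normalized ∅ x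

theorem neZero (F : InterventionalFamily μ) [Nonempty (∀ v, E v)] (v : V) : NeZero (μ v) := by
  refine ⟨fun h => ?_⟩
  have hpi : Measure.pi μ = 0 := by
    rw [← Measure.measure_univ_eq_zero, Measure.pi_univ]
    exact Finset.prod_eq_zero (Finset.mem_univ v) (by simp [h])
  have := F.lintegral_obs
  simp [hpi] at this

/-- The marginal of an interventional density on an ancestral set of nodes. -/
theorem lmarginal_dens_ae_eq [Nonempty (∀ v, E v)] (hG : IsAcyclic G) (hF : IsCompatible G F)
    {R T X : Finset V} (hT : ∀ v ∈ T, parents G v ⊆ T) (hR : R ⊆ Xᶜ) (hTR : Xᶜ \ T ⊆ R) :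
    ∫⋯∫⁻_R, F.dens X ∂μ =ᵐ[Measure.pi μ]
      ∫⋯∫⁻_(T ∩ R), ∏ i ∈ T \ X, kernel G μ F.obs i ∂μ := by
  have := F.neZero
  have hfin : ∫⁻ v, F.obs v ∂Measure.pi μ ≠ ∞ := by simp [F.lintegral_obs]
  have hR' : R = (T ∩ R) ∪ (Xᶜ \ T) := by
    ext j
    have h₁ := @hR j
    have h₂ := @hTR j
    simp only [Finset.mem_union, Finset.mem_inter, Finset.mem_sdiff] at h₂ ⊢
    tauto
  have hdisj : Disjoint (T ∩ R) (Xᶜ \ T) := by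
    rw [Finset.disjoint_left]
    intro j hj hj'
    exact (Finset.mem_sdiff.1 hj').2 (Finset.mem_inter.1 hj).1
  refine (lmarginal_congr_ae (hF.dens_ae_eq X) R).trans ?_
  rw [lmarginal_of_eq_union (measurable_prod_kernel F.measurable_obs _) hR' hdisj]
  have h := lmarginal_sdiff_prod_kernel hG F.measurable_obs F.pos hfin Xᶜ T hT
  have hinter : Xᶜ ∩ T = T \ X := by
    ext j
    simp [and_comm]
  rw [hinter] at h
  exact lmarginal_congr_ae h _

theorem marg_obs_ae_eq [Nonempty (∀ v, E v)] (hG : IsAcyclic G) (hF : IsCompatible G F)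
    {D T : Finset V} (hT : ∀ v ∈ T, parents G v ⊆ T) (hDT : D ⊆ T) :
    marg μ F.obs D =ᵐ[Measure.pi μ] ∫⋯∫⁻_(T \ D), ∏ i ∈ T, kernel G μ F.obs i ∂μ := by
  have h := F.lmarginal_dens_ae_eq hG hF (X := ∅) (R := Dᶜ) hT (by simp) (by
    intro j hj
    simp only [Finset.compl_empty, Finset.mem_sdiff, Finset.mem_univ, true_and] at hj
    exact Finset.mem_compl.2 fun h => hj (hDT h))
  rwa [Finset.sdiff_empty, ← Finset.sdiff_eq_inter_compl] at h

/-- Intervening on `X` does not change the distribution of nodes that are not descendants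
of `X`. -/
theorem lmarginal_dens_ae_eq_marg_obs [Nonempty (∀ v, E v)] (hG : IsAcyclic G)
    (hF : IsCompatible G F) {X Z : Finset V} (hanc : ∀ x ∈ X, ∀ z ∈ Z, ¬ IsAncestor G x z) :
    ∫⋯∫⁻_(X ∪ Z)ᶜ, F.dens X ∂μ =ᵐ[Measure.pi μ] marg μ F.obs Z := by
  set A := ancestors G Z with hA
  have hAX : Disjoint A X := by
    rw [Finset.disjoint_left]
    intro i hi hiX
    obtain ⟨z, hz, hiz⟩ := mem_ancestors.1 hi
    exact hanc i hiX z hz hiz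
  have hA' : ∀ v ∈ A, parents G v ⊆ A := fun v hv u hu =>
    mem_ancestors_of_adj (mem_parents.1 hu) hv
  have hZA : Z ⊆ A := subset_ancestors _ _
  have hsub : Xᶜ \ A ⊆ (X ∪ Z)ᶜ := by
    intro j hj
    have := @hZA j
    simp only [Finset.mem_sdiff, Finset.mem_compl, Finset.mem_union] at hj ⊢
    tauto
  have h := F.lmarginal_dens_ae_eq hG hF hA'
    (Finset.compl_subset_compl.2 Finset.subset_union_left) hsub
  rw [← Finset.sdiff_eq_inter_compl, sdiff_union_of_disjoint hAX,
    Finset.sdiff_eq_self_of_disjoint hAX] at h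
  exact h.trans (F.marg_obs_ae_eq hG hF hA' hZA).symm

end InterventionalFamily

variable [∀ v, SigmaFinite (μ v)]

/-- Nodes without an open walk between them given `C` are conditionally independent given `C`. -/
theorem condIndep_of_forall_not_isOpenWalk (hG : IsAcyclic G) {F : InterventionalFamily μ}
    (hF : IsCompatible G F) {a b : V} {C : Finset V} (hb : b ∉ C)
    (h : ∀ p, ¬ IsOpenWalk G C a b p) : CondIndep μ F.obs {a} {b} C := by
  rcases isEmpty_or_nonempty (∀ v, E v) with hE | hE
  · exact Filter.Eventually.of_forall fun x => hE.elim x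
  obtain ⟨B, hbB, hBC, hBa, hBT, hfam⟩ := exists_separating_set (S := {a}) hG hb
    (by simpa using h)
  set T := ancestors G (insert b ({a} ∪ C)) with hTdef
  have hT : ∀ v ∈ T, parents G v ⊆ T := fun v hv u hu =>
    mem_ancestors_of_adj (mem_parents.1 hu) hv
  have hsub : insert b ({a} ∪ C) ⊆ T := subset_ancestors _ _
  have haB : a ∉ B := by simpa using hBa
  have key : ∀ D, C ⊆ D → D ⊆ insert b ({a} ∪ C) → marg μ F.obs D =ᵐ[Measure.pi μ] _ :=
    fun D hCD hD => (F.marg_obs_ae_eq hG hF hT (hD.trans hsub)).trans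
      (Filter.EventuallyEq.of_eq
        (lmarginal_prod_kernel_eq_mul F.measurable_obs hBT hCD hfam))
  have h₁ := key ({a} ∪ {b} ∪ C) (by grind) (by grind)
  have h₂ := key C (by grind) (by grind)
  have h₃ := key ({a} ∪ C) (by grind) (by grind)
  have h₄ := key ({b} ∪ C) (by grind) (by grind)
  have hb' : Disjoint (T \ B) {b} := by simp [hbB]
  -- As `b ∈ B` and `a ∉ B`, the `B`-factor depends only on whether `b` is kept and the other factor
  -- only on whether `a` is. Both sides are therefore the product of the same four factors.
  have e₁ : B \ ({a} ∪ C) = B \ C := sdiff_union_of_disjoint hBa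
  have e₂ : B \ ({a} ∪ {b} ∪ C) = B \ ({b} ∪ C) := by
    rw [Finset.union_assoc, sdiff_union_of_disjoint hBa]
  have e₃ : (T \ B) \ ({b} ∪ C) = (T \ B) \ C := sdiff_union_of_disjoint hb'
  have e₄ : (T \ B) \ ({a} ∪ {b} ∪ C) = (T \ B) \ ({a} ∪ C) := by
    rw [Finset.union_comm {a}, Finset.union_assoc, sdiff_union_of_disjoint hb']
  rw [e₂, e₄] at h₁
  rw [e₁] at h₃
  rw [e₃] at h₄
  filter_upwards [h₁, h₂, h₃, h₄] with v h₁ h₂ h₃ h₄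
  rw [h₁, h₂, h₃, h₄]
  simp only [Pi.mul_apply]
  ring

/-- Every kernel in the truncated product is a functional of the observational density. -/
theorem isIdentifiable (G : Digraph V) (X Y : Finset V) : IsIdentifiable.{u} G X Y := by
  intro E _ μ _ F₁ F₂ h₁ h₂ hobs
  refine lmarginal_congr_ae ?_ _
  have hmarg : ∀ S, marg μ F₁.obs S =ᵐ[Measure.pi μ] marg μ F₂.obs S :=
    fun S => lmarginal_congr_ae hobs _
  have hall : ∀ᵐ v ∂Measure.pi μ, ∀ S, marg μ F₁.obs S v = marg μ F₂.obs S v :=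
    ae_all_iff.2 hmarg
  filter_upwards [h₁ X, h₂ X, hall] with v hv₁ hv₂ hv
  simp only [hv₁, hv₂, condDens, hv]

/-- The back-door criterion: `Z` is an adjustment set if it contains no descendant of `X` and
blocks all walks from `X` to `y` without edges leaving `X`. -/
theorem isAdjustmentSet_of_backdoor (hG : IsAcyclic G) {X Z : Finset V} {y : V}
    (hXZ : Disjoint X Z) (hyZ : y ∉ Z)
    (hanc : ∀ x ∈ X, ∀ z ∈ Z, ¬ IsAncestor G x z)
    (hsep : ∀ x ∈ X, ∀ p, ¬ IsOpenWalk (withoutOut G X) Z x y p) :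
    IsAdjustmentSet.{u} G X {y} Z := by
  intro E _ μ _ F hF
  rcases isEmpty_or_nonempty (∀ v, E v) with hE | hE
  · exact Filter.Eventually.of_forall fun x => hE.elim x
  have := F.neZero
  have hfin : ∫⁻ v, F.obs v ∂Measure.pi μ ≠ ∞ := by simp [F.lintegral_obs]
  obtain ⟨B, hyB, hBZ, hBX, hBT, hfam⟩ := exists_separating_set (hG.withoutOut X) hyZ hsep
  set T := ancestors (withoutOut G X) (insert y (X ∪ Z)) with hTdef
  have hsub : insert y (X ∪ Z) ⊆ T := subset_ancestors _ _
  have hT : ∀ v ∈ T, parents G v ⊆ T := by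
    intro v hv u hu
    by_cases huX : u ∈ X
    · exact hsub (by grind)
    · exact mem_ancestors_of_adj (G := withoutOut G X) ⟨mem_parents.1 hu, huX⟩ hv
  have hfamily : ∀ i, ∀ u ∈ family G i, u ∉ X → u ∈ family (withoutOut G X) i := by
    intro i u hu huX
    rcases Finset.mem_insert.1 hu with rfl | hu
    · exact Finset.mem_insert_self _ _
    · exact Finset.mem_insert_of_mem (mem_parents.2 ⟨mem_parents.1 hu, huX⟩)
  have hmeet : ∀ i ∈ T, ¬ Disjoint (family G i) B → family (withoutOut G X) i ⊆ B ∪ Z := by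
    intro i hi hd
    obtain ⟨u, hu, huB⟩ := Finset.not_disjoint_iff.1 hd
    exact hfam i hi (Finset.not_disjoint_iff.2
      ⟨u, hfamily i u hu (Finset.disjoint_left.1 hBX huB), huB⟩)
  have hfamG : ∀ i ∈ T, ¬ Disjoint (family G i) B → family G i ⊆ B ∪ (X ∪ Z) := by
    intro i hi hd u hu
    by_cases huX : u ∈ X
    · simp [huX]
    · have := hmeet i hi hd (hfamily i u hu huX)
      grind
  -- For `i ∈ X` the family cannot meet `B`, since `i` itself would then lie in `B ∪ Z`. So deleting
  -- the kernels of `X` changes only the factor away from `B`.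
  have hfilter : (T \ X).filter (fun i => ¬ Disjoint (family G i) B) =
      T.filter fun i => ¬ Disjoint (family G i) B := by
    ext i
    simp only [Finset.mem_filter, Finset.mem_sdiff]
    refine ⟨fun h => ⟨h.1.1, h.2⟩, fun h => ⟨⟨h.1, fun hiX => ?_⟩, h.2⟩⟩
    have := hmeet i h.1 h.2 (Finset.mem_insert_self _ _)
    rcases Finset.mem_union.1 this with h' | h'
    · exact Finset.disjoint_left.1 hBX h' hiX
    · exact Finset.disjoint_left.1 hXZ hiX h'
  set D := {y} ∪ (X ∪ Z) with hD
  have hDT : D ⊆ T := by grind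
  have hobs : ∀ R, X ∪ Z ⊆ R → R ⊆ D → marg μ F.obs R =ᵐ[Measure.pi μ] _ :=
    fun R hR hRD => (F.marg_obs_ae_eq hG hF hT (hRD.trans hDT)).trans
      (Filter.EventuallyEq.of_eq
        (lmarginal_prod_kernel_eq_mul F.measurable_obs hBT hR hfamG))
  have hdo : ∀ R, X ∪ Z ⊆ R → R ⊆ D → ∫⋯∫⁻_Rᶜ, F.dens X ∂μ =ᵐ[Measure.pi μ] _ :=
    fun R hR hRD => (F.lmarginal_dens_ae_eq hG hF (X := X) (R := Rᶜ) hT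
      (Finset.compl_subset_compl.2 (Finset.subset_union_left.trans hR))
      fun j hj => Finset.mem_compl.2 fun h => (Finset.mem_sdiff.1 hj).2 (hDT (hRD h))).trans
      (Filter.EventuallyEq.of_eq
        ((congrArg (fun S => ∫⋯∫⁻_S, _ ∂μ) (Finset.sdiff_eq_inter_compl T R).symm).trans
          (lmarginal_prod_kernel_eq_mul F.measurable_obs hBT hR
            fun i hi => hfamG i (Finset.mem_sdiff.1 hi).1)))
  have h₁ := hobs D (by grind) subset_rfl
  have h₂ := hobs (X ∪ Z) subset_rfl (by grind)
  have h₃ := hdo D (by grind) subset_rfl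
  have h₄ := hdo (X ∪ Z) subset_rfl (by grind)
  have e : (T \ B) \ D = (T \ B) \ (X ∪ Z) := sdiff_union_of_disjoint (by simp [hyB])
  rw [e] at h₁ h₃
  rw [hfilter] at h₃ h₄
  have h₅ := F.lmarginal_dens_ae_eq_marg_obs hG hF hanc
  have hcompl : (X ∪ {y})ᶜ = Z ∪ Dᶜ := by
    ext j
    have h₁ : j ∈ Z → j ∉ X := fun h h' => Finset.disjoint_left.1 hXZ h' h
    have h₂ : j ∈ Z → j ≠ y := fun h h' => hyZ (h' ▸ h)
    simp only [hD, Finset.mem_compl, Finset.mem_union, Finset.mem_singleton]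
    tauto
  have hdoY : F.doDens X {y} = ∫⋯∫⁻_Z, ∫⋯∫⁻_Dᶜ, F.dens X ∂μ ∂μ :=
    lmarginal_of_eq_union (F.measurable_dens X) hcompl
      (Finset.disjoint_left.2 fun j hj => by simp [hD, hj])
  rw [hdoY]
  refine lmarginal_congr_ae ?_ Z
  filter_upwards [h₁, h₂, h₃, h₄, h₅, lmarginal_pos_ae F.measurable_obs F.pos (X ∪ Z)ᶜ,
    lmarginal_lt_top_ae F.measurable_obs hfin (X ∪ Z)ᶜ] with v h₁ h₂ h₃ h₄ h₅ hpos hlt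
  change 0 < marg μ F.obs (X ∪ Z) v at hpos
  change marg μ F.obs (X ∪ Z) v < ∞ at hlt
  rw [h₂] at hpos hlt
  simp only [condDens, Pi.mul_apply] at h₁ h₂ h₃ h₄ hpos hlt ⊢
  -- With `Φ` over `B`, `Φ'` its version keeping `y`, and `Ψ`, `Ψ'` the other factors before and
  -- after intervention: `f(y | x, z) = Φ'Ψ / (ΦΨ)`, `f(z) = f(z | do(x)) = ΦΨ'` and `f(y, z |
  -- do(x)) = Φ'Ψ'`.
  rw [← h₅, h₄, h₃, h₁, h₂]
  obtain ⟨hΦ, hΨ⟩ := mul_ne_zero_iff.1 hpos.ne'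
  have hΦ' := (ENNReal.lt_top_of_mul_ne_top_left hlt.ne hΨ).ne
  have hΨ' := (ENNReal.lt_top_of_mul_ne_top_right hlt.ne hΦ).ne
  rw [ENNReal.mul_div_mul_right _ _ hΨ hΨ', ← mul_assoc, ENNReal.div_mul_cancel hΦ hΦ']

end Models

end CausalDAG

/-! ### The main theorem -/

theorem theorem2 {V : Type*} [Fintype V] [DecidableEq V]
    {E : V → Type u} [∀ v, MeasurableSpace (E v)]
    (μ : ∀ v, Measure (E v)) [∀ v, SigmaFinite (μ v)]
    (M : CausalDAG.CausalModel μ)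
    (k : ℕ) (hk : 1 ≤ k) (X : Fin k → V) (Y : V) (W : Finset V)
    (hXinj : Function.Injective X) (hXY : ∀ i, X i ≠ Y) (hXW : ∀ i, X i ∉ W) (hYW : Y ∉ W)
    (hord : CausalDAG.IsCausalOrdering M.graph
      (W :: ((List.ofFn fun i => ({X i} : Finset V)) ++ [{Y}])))
    (w : Fin k → V) (hw : ∀ i, w i ∈ W)
    (Z : Finset V) (hZ : Z ⊆ W \ Finset.univ.image w)
    (hdep : ∀ i, ¬ CausalDAG.CondIndep μ M.family.obs {w i} {Y} (Z ∪ (Finset.Iio i).image X))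
    (hind : ∀ i, CausalDAG.CondIndep μ M.family.obs {w i} {Y} (Z ∪ (Finset.Iic i).image X)) :
    (∀ i, CausalDAG.HasCausalEffect M.graph (X i) Y) ∧
      CausalDAG.IsIdentifiable.{u} M.graph (Finset.univ.image X) {Y} ∧
      CausalDAG.IsAdjustmentSet.{u} M.graph (Finset.univ.image X) {Y} Z := by
  have hG := M.acyclic
  have hZW : Z ⊆ W := fun z hz => (Finset.mem_sdiff.1 (hZ hz)).1
  have hYZ : Y ∉ Z := fun h => hYW (hZW h)
  have hwZ : ∀ i, w i ∉ Z := fun i h =>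
    (Finset.mem_sdiff.1 (hZ h)).2 (Finset.mem_image_of_mem w (Finset.mem_univ i))
  have hXZ : ∀ i, X i ∉ Z := fun i h => hXW i (hZW h)
  have hwX : ∀ i j, w i ≠ X j := fun i j h => hXW j (h ▸ hw i)
  obtain ⟨hordW, hordX⟩ := List.pairwise_cons.1 hord
  have hXanc : ∀ i, ∀ v ∈ W, ¬ CausalDAG.IsAncestor M.graph (X i) v := fun i v hv =>
    hordW {X i} (by simp) v hv (X i) (by simp)
  have hXX : ∀ i j, i < j → ¬ CausalDAG.IsAncestor M.graph (X j) (X i) := fun i j hij =>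
    List.pairwise_ofFn.1 (List.pairwise_append.1 hordX).1 hij (X i) (by simp) (X j) (by simp)
  have hXC : ∀ i, ∀ d ∈ Z ∪ (Finset.Iio i).image X, ¬ CausalDAG.IsAncestor M.graph (X i) d := by
    intro i d hd
    rcases Finset.mem_union.1 hd with hd | hd
    · exact hXanc i d (hZW hd)
    · obtain ⟨j, hj, rfl⟩ := Finset.mem_image.1 hd
      exact hXX j i (Finset.mem_Iio.1 hj)
  have hYC : ∀ s : Finset (Fin k), Y ∉ Z ∪ s.image X := by
    intro s h
    rcases Finset.mem_union.1 h with h | h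
    · exact hYZ h
    · obtain ⟨j, -, hj⟩ := Finset.mem_image.1 h
      exact hXY j hj
  have hwC : ∀ i, ∀ s : Finset (Fin k), w i ∉ Z ∪ s.image X := by
    intro i s h
    rcases Finset.mem_union.1 h with h | h
    · exact hwZ i h
    · obtain ⟨j, -, hj⟩ := Finset.mem_image.1 h
      exact hwX i j hj.symm
  have hIic : ∀ i, Z ∪ (Finset.Iic i).image X = insert (X i) (Z ∪ (Finset.Iio i).image X) := by
    intro i
    rw [← Finset.Iio_insert, Finset.image_insert, Finset.union_insert]
  have hwalk : ∀ i, ∃ p, CausalDAG.IsOpenWalk M.graph (Z ∪ (Finset.Iio i).image X) (w i) Y p := by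
    intro i
    by_contra! h
    exact hdep i (CausalDAG.condIndep_of_forall_not_isOpenWalk hG M.compatible (hYC _) h)
  have hnowalk : ∀ i p, ¬ CausalDAG.IsOpenWalk M.graph
      (insert (X i) (Z ∪ (Finset.Iio i).image X)) (w i) Y p := by
    intro i p
    rw [← hIic]
    have hwY : w i ≠ Y := fun h => hYW (h ▸ hw i)
    exact (M.faithful {w i} {Y} _ (by simpa using hwY) (Finset.disjoint_singleton_left.2 (hwC i _))
      (Finset.disjoint_singleton_left.2 (hYC _)) (hind i)).not_isOpenWalk hG p
  refine ⟨fun i => ?_, CausalDAG.isIdentifiable _ _ _, ?_⟩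
  · obtain ⟨p, hp⟩ := hwalk i
    exact hp.transGen_of_blocked (fun h => hnowalk i p ⟨hp.chain, hp.head, hp.last, h⟩)
      (hXC i) (hXanc i _ (hw i))
  · refine CausalDAG.isAdjustmentSet_of_backdoor hG ?_ hYZ ?_ ?_
    · rw [Finset.disjoint_left]
      intro v hv
      obtain ⟨i, -, rfl⟩ := Finset.mem_image.1 hv
      exact hXZ i
    · intro x hx z hz
      obtain ⟨i, -, rfl⟩ := Finset.mem_image.1 hx
      exact hXanc i z (hZW hz)
    · intro x hx q hq
      obtain ⟨i, -, rfl⟩ := Finset.mem_image.1 hx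
      obtain ⟨p, hp⟩ := hwalk i
      -- The back-door walk is open given `Z` alone; the earlier `X j` in the conditioning set
      -- cannot block it, as they occur inside it only as colliders.
      obtain ⟨r, hr⟩ := hp.exists_insert_of_withoutOut hG (hXC i) (hXanc i _ (hw i)) hq hx
        (hXY i) Finset.subset_union_left fun v hv => by
          rcases Finset.mem_union.1 hv with hv | hv
          · exact Or.inl hv
          · exact Or.inr (Finset.image_subset_image (Finset.subset_univ _) hv)
      exact hnowalk i r hr
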